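/- Let $(X(u))_{u\in\mathbb{Z}^2}$ be independent real random variables on a probability space $(\Omega,\mathcal{A},\mathbb{P})$, all with the same law $\mu$. With $e_1=(1,0)$, define the field $\alpha:\mathbb{Z}^2\to\overline{\mathbb{R}}$ by $$\alpha(u)=\sup_{r\ge 1}\frac{X(u+re_1)-X(u)}{r},$$ where $r$ ranges over the positive integers. For $\ell\in\mathbb{R}$ put $\{\alpha\le\ell\}=\{u\in\mathbb{Z}^2 : \alpha(u)\le\ell\}$ and $\{\alpha\ge\ell\}=\{u\in\mathbb{Z}^2 : \alpha(u)\ge\ell\}$. A cluster of a set $A\subset\mathbb{Z}^2$ is a connected component of $A$ for nearest-neighbour adjacency ($u\sim v$ iff $|u_1-v_1|+|u_2-v_2|=1$), and $0\overset{A}{\longleftrightarrow}\infty$ means that $0$ lies in an infinite cluster of $A$. Define, in $\overline{\mathbb{R}}$ with $\sup\emptyset=-\infty$ and $\inf\emptyset=+\infty$, the critical parameters $$\ell_c^{\le}=\sup\{\ell\in\mathbb{R} : \mathbb{P}(0\overset{\{\alpha\le\ell\}}{\longleftrightarrow}\infty)=0\},\qquad \ell_c^{\ge}=\inf\{\ell\in\mathbb{R}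 : \mathbb{P}(0\overset{\{\alpha\ge\ell\}}{\longleftrightarrow}\infty)=0\}.$$ (1) Suppose that $\mu$ has a density with respect to the Lebesgue measure on $\mathbb{R}$. Then there is $\ell_1>0$ such that for every real $\ell<\ell_1$: almost surely $\{\alpha\le\ell\}$ has no infinite cluster, and almost surely $\{\alpha\ge\ell\}$ has an infinite cluster. Moreover $0<\ell_c^{\le}$ and $0<\ell_c^{\ge}$. (2) Suppose that there are constants $c,C>0$ such that $\mu(\mathbb{R}\setminus[-x,x])\le Ce^{-cx}$ for all $x\ge 0$. Then there is $\ell_2<\infty$ such that for every real $\ell>\ell_2$: almost surely $\{\alpha\le\ell\}$ has an infinite cluster, and almost surely $\{\alpha\ge\ell\}$ has no infinite cluster. Moreover $\ell_c^{\le}<\infty$ and $\ell_c^{\ge}<\infty$. -/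

import Mathlib

open MeasureTheory ProbabilityTheory

namespace SunPercolation

/-- The square lattice: `u` and `v` in `ℤ²` are orthogonally adjacent iff
`|u₁ - v₁| + |u₂ - v₂| = 1`. -/
def lattice : SimpleGraph (ℤ × ℤ) where
  Adj u v := |u.1 - v.1| + |u.2 - v.2| = 1
  symm := ⟨fun u v h => by rw [abs_sub_comm v.1 u.1, abs_sub_comm v.2 u.2]; exact h⟩
  loopless := ⟨fun u h => by simp at h⟩

/-- The connected component of `u` in `A`: all `v` that are joined to `u` by an orthogonally
connected path using only vertices of `A` (endpoints included; it is empty if `u ∉ A`). -/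
def cluster (A : Set (ℤ × ℤ)) (u : ℤ × ℤ) : Set (ℤ × ℤ) :=
  {v | ∃ p : lattice.Walk u v, ∀ w ∈ p.support, w ∈ A}

/-- `u` is connected to infinity in `A`: its component in `A` is infinite
(for subsets of `ℤ²`, infinite and unbounded are the same). -/
def ConnectsToInfinity (A : Set (ℤ × ℤ)) (u : ℤ × ℤ) : Prop :=
  (cluster A u).Infinite

/-- The set `A` presents an infinite cluster. -/
def HasInfiniteCluster (A : Set (ℤ × ℤ)) : Prop :=
  ∃ u ∈ A, ConnectsToInfinity A u

/-- For a landscape `x : ℤ² → ℝ`, the field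
`α(u) = sup_{r ≥ 1} (x(u + r e₁) - x(u)) / r`, with values in the extended reals. -/
noncomputable def alpha (x : ℤ × ℤ → ℝ) (u : ℤ × ℤ) : EReal :=
  ⨆ (r : ℕ) (_ : 1 ≤ r), (((x (u.1 + (r : ℤ), u.2) - x u) / (r : ℝ) : ℝ) : EReal)

/-- The set `{α ≤ ℓ}` of points lit by the sun of slope `ℓ`. -/
def lit (x : ℤ × ℤ → ℝ) (ℓ : ℝ) : Set (ℤ × ℤ) := {u | alpha x u ≤ (ℓ : EReal)}

/-- The set `{α ≥ ℓ}`. -/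
def shadow (x : ℤ × ℤ → ℝ) (ℓ : ℝ) : Set (ℤ × ℤ) := {u | (ℓ : EReal) ≤ alpha x u}

/-- `μ` has a density `φ ∈ L¹(ℝ)` with respect to the Lebesgue measure. -/
def HasLebesgueDensity (μ : Measure ℝ) : Prop :=
  ∃ φ : ℝ → ℝ, Integrable φ volume ∧
    ∀ a b : ℝ, a ≤ b → μ.real (Set.Icc a b) = ∫ t in a..b, φ t

/-- `μ` has exponential tails. -/
def HasExponentialTails (μ : Measure ℝ) : Prop :=
  ∃ c C : ℝ, 0 < c ∧ 0 < C ∧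
    ∀ t : ℝ, 0 ≤ t → μ.real (Set.Icc (-t) t)ᶜ ≤ C * Real.exp (-c * t)

/-- The probability that the origin is connected to infinity in `{α ≤ ℓ}`. -/
noncomputable def thetaLe {Ω : Type*} [MeasurableSpace Ω] (P : Measure Ω)
    (X : ℤ × ℤ → Ω → ℝ) (ℓ : ℝ) : ℝ :=
  P.real {ω | ConnectsToInfinity (lit (fun u => X u ω) ℓ) (0, 0)}

/-- The probability that the origin is connected to infinity in `{α ≥ ℓ}`. -/
noncomputable def thetaGe {Ω : Type*} [MeasurableSpace Ω] (P : Measure Ω)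
    (X : ℤ × ℤ → Ω → ℝ) (ℓ : ℝ) : ℝ :=
  P.real {ω | ConnectsToInfinity (shadow (fun u => X u ω) ℓ) (0, 0)}

/-- The critical parameter of `{α ≤ ℓ}`: the supremum, in the extended reals, of the real `ℓ`
for which the origin is almost surely not connected to infinity in `{α ≤ ℓ}`. -/
noncomputable def critLe {Ω : Type*} [MeasurableSpace Ω] (P : Measure Ω)
    (X : ℤ × ℤ → Ω → ℝ) : EReal :=
  sSup ((fun ℓ : ℝ => (ℓ : EReal)) '' {ℓ : ℝ | thetaLe P X ℓ = 0})

/-- The critical parameter of `{α ≥ ℓ}`: the infimum, in the extended reals, of the real `ℓ`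
for which the origin is almost surely not connected to infinity in `{α ≥ ℓ}`. -/
noncomputable def critGe {Ω : Type*} [MeasurableSpace Ω] (P : Measure Ω)
    (X : ℤ × ℤ → Ω → ℝ) : EReal :=
  sInf ((fun ℓ : ℝ => (ℓ : EReal)) '' {ℓ : ℝ | thetaGe P X ℓ = 0})

end SunPercolation

/-!
Both parts follow from one percolation statement about *sparse* random sets `B ⊆ ℤ²`, meaning that
`P (S ⊆ B) ≤ δ ^ |S|` for every finite `S`, with a small constant `δ`. No independence of the sites
is asked for. Almost surely `B` has no infinite cluster, because a site has at most `4 ^ n`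
self-avoiding paths of length `n` (`Sparse.ae_not_hasInfiniteCluster`). The complement of `B` has
one almost surely, and contains the origin in one with positive probability. This is shown without
planar duality, by Lipschitz percolation: from a horizontal line, consider the paths that may go
down diagonally at will, and may go up only into sites that are in `B` or just below `B`. Such a
path spends at least half of its steps on distinct sites of a sparse set, so in every column a
bounded height is reached; the first heights that are missed form the graph of a Lipschitz function,
and together with the sites just above them they lie in a single cluster of the complement
(`exists_lipschitz_surface`, `connectsToInfinity_of_surface`). Since `{α ≥ ℓ}` contains the
complement of `{α ≤ ℓ}` and conversely, and since these sets are monotone in `ℓ`, it remains to see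
that `{α ≤ ℓ}` is sparse for some `ℓ > 0` if the law is continuous, and that `{α ≥ ℓ}` is sparse for
some `ℓ` if the tails are exponential.

*Continuous laws* (`exists_sparse_lit`). A site of `{α ≤ 0}` carries the maximum of all values to
its right. Cut the rows into segments of length `R`. By exchangeability, `k` given sites of a segment
all carry the maximum of what follows, up to the end of the next segment, with probability at most
`R ^ (-k)` (`card_pow_mul_measure_chain_le`). Only finitely many patterns of sites occur in a
segment, so by continuity `(2 / R) ^ k` is an upper bound for some positive `ℓ`. Every other segment
gives independent events, whence the bound `(2 / R) ^ (|S| / 2)`.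

*Exponential tails* (`exists_sparse_shadow`). If `α(u) ≥ 4κ` then `|X| > κ max(1, r)` at the site `r`
steps to the right of `u`, for some `r ≥ 0`: that site covers `u`. The number of sites of `S` covered
by each site is a function of the value at that site alone, so an exponential Markov inequality and
independence bound the probability that all of `S` is covered (`measure_covered_le`).
-/

open Filter
open scoped ENNReal

namespace SunPercolation

/-! ### Self-avoiding paths -/

theorem exists_injOn_path {α : Type*} {r : α → α → Prop} {a b : α}
    (h : Relation.ReflTransGen r a b) :
    ∃ (n : ℕ) (x : ℕ → α), x 0 = a ∧ x n = b ∧ (∀ i < n, r (x i) (x (i + 1))) ∧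
      Set.InjOn x (Set.Iic n) := by
  classical
  have hex : ∃ (n : ℕ) (x : ℕ → α), x 0 = a ∧ x n = b ∧ ∀ i < n, r (x i) (x (i + 1)) := by
    induction h with
    | refl => exact ⟨0, fun _ => a, rfl, rfl, by simp⟩
    | @tail b c _ hbc ih =>
      obtain ⟨n, x, h0, hn, hx⟩ := ih
      refine ⟨n + 1, fun k => if k ≤ n then x k else c, by simpa using h0, by simp,
        fun i hi => ?_⟩
      rcases Nat.lt_succ_iff_lt_or_eq.mp hi with hi | rfl
      · simpa [hi.le, Nat.succ_le_of_lt hi] using hx i hi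
      · simpa [hn] using hbc
  obtain ⟨n, ⟨x, h0, hn, hx⟩, hmin⟩ : ∃ n, (∃ x : ℕ → α, x 0 = a ∧ x n = b ∧
      ∀ i < n, r (x i) (x (i + 1))) ∧ ∀ m < n, ¬ ∃ x : ℕ → α, x 0 = a ∧ x m = b ∧
      ∀ i < m, r (x i) (x (i + 1)) :=
    ⟨Nat.find hex, Nat.find_spec hex, fun m hm => Nat.find_min hex hm⟩
  refine ⟨n, x, h0, hn, hx, ?_⟩
  -- A repeated vertex would allow a loop to be cut out, against the minimality of the length.
  have key : ∀ i j, i < j → j ≤ n → x i ≠ x j := by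
    intro i j hij hj hxe
    have hlt : n - (j - i) < n := by omega
    refine hmin _ hlt
      ⟨fun k => if k ≤ i then x k else x (k + (j - i)), by simpa using h0, ?_, fun k hk => ?_⟩
    · rcases eq_or_lt_of_le hj with hjn | hj'
      · have : n - (j - i) = i := by omega
        simp only [this, le_refl, if_true]
        rw [hxe, hjn, hn]
      · have h1 : ¬ n - (j - i) ≤ i := by omega
        have h2 : n - (j - i) + (j - i) = n := by omega
        simpa [h1, h2] using hn
    · rcases lt_trichotomy k i with hk' | rfl | hk'
      · simpa [hk'.le, Nat.succ_le_of_lt hk'] using hx k (by omega)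
      · have h2 : k + 1 + (j - k) = j + 1 := by omega
        simpa [h2, hxe] using hx j (by omega)
      · have h1 : ¬ k ≤ i := by omega
        have h1' : ¬ k + 1 ≤ i := by omega
        have h2 : k + 1 + (j - i) = k + (j - i) + 1 := by omega
        simpa [h1, h1', h2] using hx (k + (j - i)) (by omega)
  intro i hi j hj hxe
  rcases lt_trichotomy i j with h | h | h
  · exact (key i j h hj hxe).elim
  · exact h
  · exact (key j i h hi hxe.symm).elim

variable {Ω : Type*} [MeasurableSpace Ω]

/-- A random subset `B` of `ℤ²` is `δ`-sparse if any given finite set `S` is contained in `B` with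
(outer) probability at most `δ ^ |S|`. -/
def Sparse (P : Measure Ω) (B : Ω → Set (ℤ × ℤ)) (δ : ℝ≥0∞) : Prop :=
  ∀ S : Finset (ℤ × ℤ), P {ω | (S : Set (ℤ × ℤ)) ⊆ B ω} ≤ δ ^ S.card

/-- The position after `i` steps of the path that starts at `u` and has the increments `w`. -/
def wordPos {D : Finset (ℤ × ℤ)} {n : ℕ} (u : ℤ × ℤ) (w : Fin n → D) (i : ℕ) : ℤ × ℤ :=
  u + ∑ j ∈ Finset.range i, if h : j < n then (w ⟨j, h⟩ : ℤ × ℤ) else 0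

theorem wordPos_eq {D : Finset (ℤ × ℤ)} {n : ℕ} {x : ℕ → ℤ × ℤ} {w : Fin n → D}
    (hw : ∀ (j : ℕ) (h : j < n), (w ⟨j, h⟩ : ℤ × ℤ) = x (j + 1) - x j) {i : ℕ} (hi : i ≤ n) :
    wordPos (x 0) w i = x i := by
  induction i with
  | zero => simp [wordPos]
  | succ k ih =>
    have := ih (by omega)
    rw [wordPos] at this ⊢
    rw [Finset.sum_range_succ, ← add_assoc, this, dif_pos (by omega : k < n), hw]
    abel

/-- The union bound over self-avoiding paths: there are at most `|D| ^ n` paths of `n` steps in `D`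
from a given point, and each is charged for the sites it leaves by a step in `E`. -/
theorem Sparse.measure_paths_le {P : Measure Ω} {B : Ω → Set (ℤ × ℤ)} {δ : ℝ≥0∞}
    (hB : Sparse P B δ) (hδ : δ ≤ 1) (D E : Finset (ℤ × ℤ)) (u : ℤ × ℤ) (n k : ℕ) :
    P {ω | ∃ x : ℕ → ℤ × ℤ, x 0 = u ∧ Set.InjOn x (Set.Iic n) ∧ (∀ i < n, x (i + 1) - x i ∈ D) ∧
      (∀ i < n, x (i + 1) - x i ∈ E → x i ∈ B ω) ∧
      k ≤ ((Finset.range n).filter fun i => x (i + 1) - x i ∈ E).card} ≤ D.card ^ n * δ ^ k := by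
  classical
  let S : (Fin n → D) → Finset (ℤ × ℤ) := fun w =>
    ((Finset.range n).filter fun i => wordPos u w (i + 1) - wordPos u w i ∈ E).image (wordPos u w)
  have hsub : {ω | ∃ x : ℕ → ℤ × ℤ, x 0 = u ∧ Set.InjOn x (Set.Iic n) ∧
      (∀ i < n, x (i + 1) - x i ∈ D) ∧ (∀ i < n, x (i + 1) - x i ∈ E → x i ∈ B ω) ∧
      k ≤ ((Finset.range n).filter fun i => x (i + 1) - x i ∈ E).card} ⊆
      ⋃ w ∈ (Finset.univ : Finset (Fin n → D)).filter (fun w => k ≤ (S w).card),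
        {ω | (S w : Set (ℤ × ℤ)) ⊆ B ω} := by
    rintro ω ⟨x, rfl, hinj, hD, hE, hk⟩
    let w : Fin n → D := fun i => ⟨x (i + 1) - x i, hD i i.2⟩
    have hpos : ∀ i ≤ n, wordPos (x 0) w i = x i := fun i hi =>
      wordPos_eq (x := x) (w := w) (fun _ _ => rfl) hi
    have hS : S w = ((Finset.range n).filter fun i => x (i + 1) - x i ∈ E).image x := by
      have hf : ((Finset.range n).filter fun i =>
          wordPos (x 0) w (i + 1) - wordPos (x 0) w i ∈ E) =
          (Finset.range n).filter fun i => x (i + 1) - x i ∈ E := by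
        refine Finset.filter_congr fun i hi => ?_
        have := Finset.mem_range.mp hi
        rw [hpos i (by omega), hpos (i + 1) (by omega)]
      simp only [S, hf]
      refine Finset.image_congr fun i hi => ?_
      have := (Finset.mem_filter.mp hi).1
      exact hpos i (Finset.mem_range.mp this).le
    have hcard : (S w).card = ((Finset.range n).filter fun i => x (i + 1) - x i ∈ E).card := by
      rw [hS]
      refine Finset.card_image_of_injOn (hinj.mono fun i hi => ?_)
      have := (Finset.mem_filter.mp hi).1
      exact (Finset.mem_range.mp this).le
    simp only [Set.mem_iUnion]
    refine ⟨w, by simp [hcard, hk], ?_⟩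
    intro v hv
    rw [hS] at hv
    simp only [Finset.coe_image, Set.mem_image, Finset.mem_coe, Finset.mem_filter,
      Finset.mem_range] at hv
    obtain ⟨i, ⟨hi, hiE⟩, rfl⟩ := hv
    exact hE i hi hiE
  calc _ ≤ _ := measure_mono hsub
    _ ≤ ∑ w ∈ (Finset.univ : Finset (Fin n → D)).filter (fun w => k ≤ (S w).card),
        P {ω | (S w : Set (ℤ × ℤ)) ⊆ B ω} := measure_biUnion_finset_le _ _
    _ ≤ ∑ w ∈ (Finset.univ : Finset (Fin n → D)).filter (fun w => k ≤ (S w).card), δ ^ k := by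
        refine Finset.sum_le_sum fun w hw => (hB _).trans ?_
        exact pow_le_pow_of_le_one zero_le hδ (Finset.mem_filter.mp hw).2
    _ ≤ ∑ w : Fin n → D, δ ^ k := Finset.sum_le_sum_of_subset (Finset.filter_subset _ _)
    _ = D.card ^ n * δ ^ k := by simp

/-! ### Sparse sets have no infinite cluster -/

theorem eq_zero_of_le_geometric {a C r : ℝ≥0∞} (hC : C ≠ ∞) (hr : r < 1)
    (h : ∀ n : ℕ, a ≤ C * r ^ n) : a = 0 := by
  have h1 : Filter.Tendsto (fun n : ℕ => C * r ^ n) Filter.atTop (nhds (C * 0)) :=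
    ENNReal.Tendsto.const_mul (ENNReal.tendsto_pow_atTop_nhds_zero_of_lt_one hr) (Or.inr hC)
  rw [mul_zero] at h1
  exact le_antisymm (ge_of_tendsto' h1 h) bot_le

theorem exists_path_of_connectsToInfinity {A : Set (ℤ × ℤ)} {u : ℤ × ℤ}
    (h : ConnectsToInfinity A u) (n : ℕ) :
    ∃ x : ℕ → ℤ × ℤ, x 0 = u ∧ Set.InjOn x (Set.Iic n) ∧
      ∀ i < n, lattice.Adj (x i) (x (i + 1)) ∧ x i ∈ A := by
  obtain ⟨v, ⟨p, hp⟩, hv⟩ := h.exists_notMem_finite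
    (Set.finite_Icc ((u.1 - n, u.2 - n) : ℤ × ℤ) (u.1 + n, u.2 + n))
  have hpath : Relation.ReflTransGen (fun a b => lattice.Adj a b ∧ a ∈ A) u v := by
    clear hv h
    induction p with
    | nil => exact .refl
    | cons hadj q ih =>
      refine Relation.ReflTransGen.head ⟨hadj, hp _ (by simp)⟩ (ih (fun w hw => hp w (by simp [hw])))
  obtain ⟨m, x, h0, hm, hx, hinj⟩ := exists_injOn_path hpath
  have hdist : ∀ i ≤ m, |(x i).1 - u.1| + |(x i).2 - u.2| ≤ i := by
    intro i
    induction i with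
    | zero => simp [h0]
    | succ k ih =>
      intro hk
      have h1 := ih (by omega)
      have h2 : |(x k).1 - (x (k + 1)).1| + |(x k).2 - (x (k + 1)).2| = 1 := (hx k (by omega)).1
      push_cast
      grind
  have hnm : n ≤ m := by
    by_contra hlt
    have h1 := hdist m le_rfl
    rw [hm] at h1
    apply hv
    obtain ⟨h2, h3⟩ := abs_le.mp (show |v.1 - u.1| ≤ m by linarith [abs_nonneg (v.2 - u.2)])
    obtain ⟨h4, h5⟩ := abs_le.mp (show |v.2 - u.2| ≤ m by linarith [abs_nonneg (v.1 - u.1)])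
    exact ⟨⟨by simp only; omega, by simp only; omega⟩, by simp only; omega, by simp only; omega⟩
  exact ⟨x, h0, hinj.mono (Set.Iic_subset_Iic.mpr hnm), fun i hi => hx i (by omega)⟩

theorem Sparse.ae_not_hasInfiniteCluster {P : Measure Ω} {B : Ω → Set (ℤ × ℤ)} {δ : ℝ≥0∞}
    (hB : Sparse P B δ) (hδ : 4 * δ < 1) : ∀ᵐ ω ∂P, ¬ HasInfiniteCluster (B ω) := by
  have hδ1 : δ ≤ 1 := le_trans (by simpa using mul_le_mul_left (by norm_num : (1 : ℝ≥0∞) ≤ 4) δ)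
    hδ.le
  have hu : ∀ u, ∀ᵐ ω ∂P, ¬ ConnectsToInfinity (B ω) u := by
    intro u
    rw [ae_iff]
    simp only [not_not]
    let D : Finset (ℤ × ℤ) := {(1, 0), (-1, 0), (0, 1), (0, -1)}
    refine eq_zero_of_le_geometric (C := 1) (by simp) hδ fun n => ?_
    refine (measure_mono ?_).trans
      ((hB.measure_paths_le hδ1 D D u n n).trans (le_of_eq ?_))
    · intro ω hω
      obtain ⟨x, h0, hinj, hx⟩ := exists_path_of_connectsToInfinity hω n
      have hD : ∀ i < n, x (i + 1) - x i ∈ D := by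
        intro i hi
        have h2 : |(x i).1 - (x (i + 1)).1| + |(x i).2 - (x (i + 1)).2| = 1 := (hx i hi).1
        simp only [D, Finset.mem_insert, Finset.mem_singleton, Prod.ext_iff, Prod.fst_sub,
          Prod.snd_sub]
        grind
      refine ⟨x, h0, hinj, hD, fun i hi _ => (hx i hi).2, ?_⟩
      rw [Finset.filter_true_of_mem (fun i hi => hD i (Finset.mem_range.mp hi))]
      simp
    · have : D.card = 4 := by decide
      rw [this, one_mul, mul_pow]
      norm_num
  filter_upwards [ae_all_iff.mpr hu] with ω hω
  rintro ⟨u, _, hu⟩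
  exact hω u hu

/-! ### Lipschitz surfaces -/

/-- The sites `u` such that `u` or the site above it lies in `B`. -/
def thicken (B : Set (ℤ × ℤ)) : Set (ℤ × ℤ) := {u | u ∈ B ∨ u + (0, 1) ∈ B}

/-- One step, read backwards, of an admissible path: such a path may always go down diagonally, and
may go up into a site of `C`. -/
def BackStep (C : Set (ℤ × ℤ)) (v u : ℤ × ℤ) : Prop :=
  (u - v = (0, -1) ∧ v ∈ C) ∨ u - v = (1, 1) ∨ u - v = (-1, 1)

/-- The site `v` is the endpoint of an admissible path that starts at height `b`. -/
def Reachable (C : Set (ℤ × ℤ)) (b : ℤ) (v : ℤ × ℤ) : Prop :=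
  ∃ u : ℤ × ℤ, u.2 = b ∧ Relation.ReflTransGen (BackStep C) v u

theorem Reachable.of_backStep {C : Set (ℤ × ℤ)} {b : ℤ} {v u : ℤ × ℤ} (h : Reachable C b u)
    (hs : BackStep C v u) : Reachable C b v := by
  obtain ⟨w, hw, hp⟩ := h
  exact ⟨w, hw, hp.head hs⟩

/-- If admissible paths from height `b` reach only a bounded height in each column, the first
heights they miss form a Lipschitz surface that avoids `C`. -/
theorem exists_lipschitz_surface {C : Set (ℤ × ℤ)} {b : ℤ}
    (hb : ∀ x, ∃ M, ∀ y, Reachable C b (x, y) → y ≤ M) :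
    ∃ F : ℤ → ℤ, ∀ x, (x, F x) ∉ C ∧ Reachable C b (x, F x - 1) ∧ b < F x ∧
      F (x + 1) ≤ F x + 1 ∧ F x ≤ F (x + 1) + 1 := by
  have hmax : ∀ x, ∃ y, Reachable C b (x, y) ∧ ∀ z, Reachable C b (x, z) → z ≤ y := fun x =>
    Int.exists_greatest_of_bdd (hb x) ⟨b, (x, b), rfl, .refl⟩
  choose G hG hGmax using hmax
  refine ⟨fun x => G x + 1, fun x => ⟨fun hC => ?_, by simpa using hG x, ?_, ?_, ?_⟩⟩
  · have := hGmax x (G x + 1) ((hG x).of_backStep (Or.inl ⟨by simp, hC⟩))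
    omega
  · have := hGmax x b ⟨(x, b), rfl, .refl⟩
    exact Int.lt_add_one_of_le this
  · have := hGmax x (G (x + 1) - 1) ((hG (x + 1)).of_backStep (Or.inr (Or.inl (by simp))))
    simp only
    omega
  · have := hGmax (x + 1) (G x - 1) ((hG x).of_backStep (Or.inr (Or.inr (by simp))))
    simp only
    omega

theorem mem_cluster_of_adj {A : Set (ℤ × ℤ)} {u v w : ℤ × ℤ} (hv : v ∈ cluster A u)
    (h : lattice.Adj v w) (hw : w ∈ A) : w ∈ cluster A u := by
  obtain ⟨p, hp⟩ := hv
  refine ⟨p.concat h, fun z hz => ?_⟩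
  rw [SimpleGraph.Walk.support_concat, List.mem_append,
    List.mem_singleton] at hz
  rcases hz with hz | rfl
  · exact hp z hz
  · exact hw

/-- Consecutive points of a Lipschitz surface that avoids `thicken B` are joined outside `B` through
the site just above the lower one of the two. -/
theorem connectsToInfinity_of_surface {B : Set (ℤ × ℤ)} {F : ℤ → ℤ}
    (hF : ∀ x, (x, F x) ∉ thicken B ∧ F (x + 1) ≤ F x + 1 ∧ F x ≤ F (x + 1) + 1) (x : ℤ) :
    ConnectsToInfinity Bᶜ (x, F x) := by
  have h0 : ∀ x, (x, F x) ∈ Bᶜ := fun x h => (hF x).1 (Or.inl h)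
  have h1 : ∀ x, (x, F x + 1) ∈ Bᶜ := fun x h => (hF x).1 (Or.inr (by simpa using h))
  have hadj : ∀ a b c d : ℤ, (c - a = 0 ∧ |d - b| = 1) ∨ (|c - a| = 1 ∧ d - b = 0) →
      lattice.Adj (a, b) (c, d) := by
    intro a b c d h
    change |a - c| + |b - d| = 1
    rw [abs_sub_comm a, abs_sub_comm b]
    rcases h with ⟨h, h'⟩ | ⟨h, h'⟩ <;> simp [h, h']
  have hmem : ∀ k : ℕ, (x + k, F (x + k)) ∈ cluster Bᶜ (x, F x) := by
    intro k
    induction k with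
    | zero =>
      refine ⟨SimpleGraph.Walk.nil.copy rfl (by simp), fun w hw => ?_⟩
      simp only [SimpleGraph.Walk.support_copy, SimpleGraph.Walk.support_nil,
        List.mem_singleton] at hw
      exact hw ▸ h0 x
    | succ k ih =>
      push_cast
      rw [← add_assoc]
      obtain ⟨-, hup, hdown⟩ := hF (x + k)
      generalize x + (k : ℤ) = z at *
      rcases (by omega : F (z + 1) = F z ∨ F (z + 1) = F z + 1 ∨ F z = F (z + 1) + 1) with h | h | h
      · exact mem_cluster_of_adj ih (hadj _ _ _ _ (Or.inr (by simp [h]))) (h0 _)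
      · exact mem_cluster_of_adj (mem_cluster_of_adj ih
          (hadj _ _ z (F z + 1) (Or.inl (by simp))) (h1 _))
          (hadj _ _ _ _ (Or.inr (by simp [h]))) (h0 _)
      · exact mem_cluster_of_adj (mem_cluster_of_adj ih
          (hadj _ _ (z + 1) (F (z + 1) + 1) (Or.inr (by simp [h]))) (h1 _))
          (hadj _ _ _ _ (Or.inl (by simp))) (h0 _)
  refine Set.infinite_of_injective_forall_mem (f := fun k : ℕ => (x + (k : ℤ), F (x + k)))
    (fun i j h => ?_) hmem
  simpa using congrArg Prod.fst h

/-- Each site of `S ⊆ thicken B` has a witness in `B`, the site itself or the one above it, and a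
witness serves at most two sites; there are `2 ^ |S|` ways to choose them. -/
theorem Sparse.thicken {P : Measure Ω} {B : Ω → Set (ℤ × ℤ)} {t : ℝ≥0∞} (ht : t ≤ 1)
    (hB : Sparse P B (t ^ 2)) : Sparse P (fun ω => thicken (B ω)) (2 * t) := by
  classical
  intro S
  let up : ℤ × ℤ → ℤ × ℤ := fun u => u + (0, 1)
  have hup : Function.Injective up := add_left_injective _
  let Q : Finset (ℤ × ℤ) → Finset (ℤ × ℤ) := fun T => T ∪ (S \ T).image up
  have hQ : ∀ T ∈ S.powerset, S.card ≤ 2 * (Q T).card := by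
    intro T hT
    have h1 : T.card ≤ (Q T).card := Finset.card_le_card Finset.subset_union_left
    have h2 : (S \ T).card ≤ (Q T).card := by
      rw [← Finset.card_image_of_injective _ hup]
      exact Finset.card_le_card Finset.subset_union_right
    have h3 := Finset.card_sdiff_add_card_eq_card (Finset.mem_powerset.mp hT)
    omega
  calc P {ω | (S : Set (ℤ × ℤ)) ⊆ SunPercolation.thicken (B ω)}
      ≤ P (⋃ T ∈ S.powerset, {ω | (Q T : Set (ℤ × ℤ)) ⊆ B ω}) := by
        refine measure_mono fun ω hω => ?_
        simp only [Set.mem_iUnion]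
        refine ⟨S.filter (· ∈ B ω), by simp, fun v hv => ?_⟩
        simp only [Q, Finset.coe_union, Finset.coe_image, Set.mem_union, Set.mem_image,
          Finset.mem_coe, Finset.mem_sdiff, Finset.mem_filter] at hv
        rcases hv with hv | ⟨w, ⟨hw, hwB⟩, rfl⟩
        · exact hv.2
        · exact (hω hw).resolve_left fun h => hwB ⟨hw, h⟩
    _ ≤ ∑ T ∈ S.powerset, P {ω | (Q T : Set (ℤ × ℤ)) ⊆ B ω} := measure_biUnion_finset_le _ _
    _ ≤ ∑ T ∈ S.powerset, t ^ S.card := by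
        refine Finset.sum_le_sum fun T hT => (hB _).trans ?_
        rw [← pow_mul]
        exact pow_le_pow_of_le_one zero_le ht (hQ T hT)
    _ = (2 * t) ^ S.card := by simp [mul_pow]

/-- Reaching the height `b + h` takes an admissible path of at least `h` steps, at least half of
which go up. -/
theorem Reachable.exists_path {C : Set (ℤ × ℤ)} {b : ℤ} {v : ℤ × ℤ} (hv : Reachable C b v) {h : ℕ}
    (hh : v.2 = b + h) :
    ∃ n ≥ h, ∃ x : ℕ → ℤ × ℤ, x 0 = v ∧ Set.InjOn x (Set.Iic n) ∧
      (∀ i < n, x (i + 1) - x i ∈ ({(0, -1), (1, 1), (-1, 1)} : Finset (ℤ × ℤ))) ∧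
      (∀ i < n, x (i + 1) - x i ∈ ({(0, -1)} : Finset (ℤ × ℤ)) → x i ∈ C) ∧
      n ≤ 2 * ((Finset.range n).filter fun i =>
        x (i + 1) - x i ∈ ({(0, -1)} : Finset (ℤ × ℤ))).card := by
  obtain ⟨u, hu, hp⟩ := hv
  obtain ⟨n, x, h0, hn, hx, hinj⟩ := exists_injOn_path hp
  have hcount : ∀ m ≤ n, (x 0).2 - (x m).2 + m = 2 * ((Finset.range m).filter fun i =>
      x (i + 1) - x i ∈ ({(0, -1)} : Finset (ℤ × ℤ))).card := by
    intro m
    induction m with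
    | zero => simp
    | succ m ih =>
      intro hm
      have h1 := ih (by omega)
      rw [Finset.range_add_one, Finset.filter_insert]
      rcases hx m (by omega) with ⟨h2, -⟩ | h2 | h2
      · have h3 := congrArg Prod.snd h2
        simp only [Prod.snd_sub] at h3
        rw [if_pos (by simp [h2]), Finset.card_insert_of_notMem (by simp)]
        push_cast
        omega
      all_goals
        have h3 := congrArg Prod.snd h2
        simp only [Prod.snd_sub] at h3
        rw [if_neg (by simp [h2])]
        push_cast
        omega
  have hfin := hcount n le_rfl
  have hle := Finset.card_filter_le (Finset.range n) fun i =>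
    x (i + 1) - x i ∈ ({(0, -1)} : Finset (ℤ × ℤ))
  rw [Finset.card_range] at hle
  rw [h0, hn] at hfin
  refine ⟨n, by omega, x, h0, hinj, fun i hi => ?_, fun i hi hE => ?_, by omega⟩
  · rcases hx i hi with ⟨h2, -⟩ | h2 | h2 <;> simp [h2]
  · rcases hx i hi with ⟨-, h2⟩ | h2 | h2
    · exact h2
    · simp [h2] at hE
    · simp [h2] at hE

theorem tsum_geometric_tail_le {r : ℝ≥0∞} (hr : r ≤ 2⁻¹) (h : ℕ) :
    ∑' j : ℕ, r ^ (h + j) ≤ 2 * r ^ h := by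
  simp_rw [pow_add]
  rw [ENNReal.tsum_mul_left, ENNReal.tsum_geometric, mul_comm]
  gcongr
  rw [ENNReal.inv_le_iff_inv_le, ← ENNReal.one_sub_inv_two]
  gcongr

/-- The admissible paths are summed over their length `n ≥ h`; there are `3 ^ n` of them, and at least
`n / 2` distinct sites of `C` on each. -/
theorem Sparse.measure_reachable_le {P : Measure Ω} {C : Ω → Set (ℤ × ℤ)} {q : ℝ≥0∞}
    (hC : Sparse P C (q ^ 2)) (hq : 3 * q ≤ 2⁻¹) (x b : ℤ) (h : ℕ) :
    P {ω | ∃ y ≥ b + h, Reachable (C ω) b (x, y)} ≤ 4 * (3 * q) ^ h := by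
  have hq1 : q ≤ 1 := by
    calc q ≤ 3 * q := by simpa using mul_le_mul_left (by norm_num : (1 : ℝ≥0∞) ≤ 3) q
      _ ≤ 2⁻¹ := hq
      _ ≤ 1 := by simp
  let D : Finset (ℤ × ℤ) := {(0, -1), (1, 1), (-1, 1)}
  let E : Finset (ℤ × ℤ) := {(0, -1)}
  let G : ℤ × ℤ → ℕ → Set Ω := fun v n => {ω | ∃ x : ℕ → ℤ × ℤ, x 0 = v ∧
      Set.InjOn x (Set.Iic n) ∧ (∀ i < n, x (i + 1) - x i ∈ D) ∧
      (∀ i < n, x (i + 1) - x i ∈ E → x i ∈ C ω) ∧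
      (n + 1) / 2 ≤ ((Finset.range n).filter fun i => x (i + 1) - x i ∈ E).card}
  have hG : ∀ v n, P (G v n) ≤ (3 * q) ^ n := by
    intro v n
    refine (hC.measure_paths_le (pow_le_one₀ zero_le hq1) D E v n _).trans ?_
    have hD : D.card = 3 := by decide
    rw [hD, mul_pow, ← pow_mul]
    push_cast
    refine mul_le_mul_right ?_ _
    exact pow_le_pow_of_le_one zero_le hq1 (by omega)
  calc P {ω | ∃ y ≥ b + h, Reachable (C ω) b (x, y)}
      ≤ P (⋃ k : ℕ, ⋃ j : ℕ, G (x, b + (h + k : ℕ)) (h + k + j)) := by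
        refine measure_mono fun ω hω => ?_
        obtain ⟨y, hy, hreach⟩ := hω
        obtain ⟨k, rfl⟩ : ∃ k : ℕ, y = b + (h + k : ℕ) :=
          ⟨(y - b - h).toNat, by omega⟩
        obtain ⟨n, hn, z, h0, hinj, hD, hE, hcard⟩ := hreach.exists_path (h := h + k) rfl
        obtain ⟨j, rfl⟩ := Nat.exists_eq_add_of_le hn
        refine Set.mem_iUnion₂.mpr ⟨k, j, z, h0, hinj, hD, hE, ?_⟩
        simp only [E]
        omega
    _ ≤ ∑' k : ℕ, ∑' j : ℕ, P (G (x, b + (h + k : ℕ)) (h + k + j)) :=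
        (measure_iUnion_le _).trans (ENNReal.tsum_le_tsum fun k => measure_iUnion_le _)
    _ ≤ ∑' k : ℕ, ∑' j : ℕ, (3 * q) ^ (h + k + j) :=
        ENNReal.tsum_le_tsum fun k => ENNReal.tsum_le_tsum fun j => hG _ _
    _ ≤ ∑' k : ℕ, 2 * (3 * q) ^ (h + k) :=
        ENNReal.tsum_le_tsum fun k => tsum_geometric_tail_le hq _
    _ ≤ 2 * (2 * (3 * q) ^ h) := by
        rw [ENNReal.tsum_mul_left]
        gcongr
        exact tsum_geometric_tail_le hq _
    _ = 4 * (3 * q) ^ h := by rw [← mul_assoc]; norm_num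

/-! ### Complements of sparse sets percolate -/

theorem Sparse.ae_bounded_reachable {P : Measure Ω} {C : Ω → Set (ℤ × ℤ)} {q : ℝ≥0∞}
    (hC : Sparse P C (q ^ 2)) (hq : 3 * q ≤ 2⁻¹) (b : ℤ) :
    ∀ᵐ ω ∂P, ∀ x, ∃ M, ∀ y, Reachable (C ω) b (x, y) → y ≤ M := by
  refine ae_all_iff.mpr fun x => ?_
  rw [ae_iff]
  refine eq_zero_of_le_geometric (C := 4) (r := 3 * q) (by simp)
    (hq.trans_lt (by simp)) fun h => ?_
  refine (measure_mono fun ω hω => ?_).trans (hC.measure_reachable_le hq x b h)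
  simp only [Set.mem_ofPred_eq, not_exists, not_forall, not_le] at hω ⊢
  obtain ⟨y, hy, hlt⟩ := hω (b + h)
  exact ⟨y, hlt.le, hy⟩

/-- The constants are chosen so that `3 * 24⁻¹ ≤ 1 / 8`: the bound `4 * (1 / 8) ^ h` on the
probability of reaching height `h` is then less than `1` already for `h = 1`. -/
theorem Sparse.thicken_const {P : Measure Ω} {B : Ω → Set (ℤ × ℤ)}
    (hB : Sparse P B ((1152⁻¹ : ℝ≥0∞) ^ 2)) :
    Sparse P (fun ω => SunPercolation.thicken (B ω)) ((24⁻¹ : ℝ≥0∞) ^ 2) := by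
  have h : 2 * (1152⁻¹ : ℝ≥0∞) = 24⁻¹ ^ 2 := by
    rw [← ENNReal.toReal_eq_toReal_iff' (by finiteness) (by finiteness)]
    simp
    norm_num
  exact h ▸ hB.thicken (by simp)

theorem three_mul_inv_le : 3 * (24⁻¹ : ℝ≥0∞) ≤ 8⁻¹ := by
  rw [← ENNReal.toReal_le_toReal (by finiteness) (by finiteness)]
  simp
  norm_num

theorem Sparse.ae_hasInfiniteCluster_compl {P : Measure Ω} {B : Ω → Set (ℤ × ℤ)}
    (hB : Sparse P B ((1152⁻¹ : ℝ≥0∞) ^ 2)) : ∀ᵐ ω ∂P, HasInfiniteCluster (B ω)ᶜ := by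
  have hq : 3 * (24⁻¹ : ℝ≥0∞) ≤ 2⁻¹ := three_mul_inv_le.trans (by gcongr; norm_num)
  filter_upwards [hB.thicken_const.ae_bounded_reachable hq 0] with ω hω
  obtain ⟨F, hF⟩ := exists_lipschitz_surface hω
  exact ⟨(0, F 0), fun h => (hF 0).1 (Or.inl h),
    connectsToInfinity_of_surface (fun x => ⟨(hF x).1, (hF x).2.2.2⟩) 0⟩

theorem Sparse.measure_connectsToInfinity_compl_ne_zero {P : Measure Ω} [IsProbabilityMeasure P]
    {B : Ω → Set (ℤ × ℤ)} (hB : Sparse P B ((1152⁻¹ : ℝ≥0∞) ^ 2)) :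
    P {ω | ConnectsToInfinity (B ω)ᶜ (0, 0)} ≠ 0 := by
  intro h0
  have hq : 3 * (24⁻¹ : ℝ≥0∞) ≤ 2⁻¹ := three_mul_inv_le.trans (by gcongr; norm_num)
  have hbad := hB.thicken_const.measure_reachable_le hq 0 (-1) 1
  have hlt : 4 * (3 * (24⁻¹ : ℝ≥0∞)) ^ 1 < 1 := by
    rw [pow_one, ← ENNReal.toReal_lt_toReal (by finiteness) (by finiteness)]
    simp
    norm_num
  -- If no site of the column of the origin at height `≥ 0` is reached from height `-1`, the surface
  -- passes through the origin.
  have hconn : ∀ᵐ ω ∂P, ω ∈ {ω | ∃ y ≥ (-1 : ℤ) + (1 : ℕ),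
      Reachable (SunPercolation.thicken (B ω)) (-1) (0, y)} := by
    filter_upwards [hB.thicken_const.ae_bounded_reachable hq (-1), measure_eq_zero_iff_ae_notMem.mp h0]
      with ω hω hn
    by_contra hno
    obtain ⟨F, hF⟩ := exists_lipschitz_surface hω
    have h1 := connectsToInfinity_of_surface (fun x => ⟨(hF x).1, (hF x).2.2.2⟩) 0
    have h2 : F 0 = 0 := by
      have h3 := (hF 0).2.2.1
      by_contra h4
      exact hno ⟨F 0 - 1, by push_cast; omega, (hF 0).2.1⟩
    rw [h2] at h1
    exact hn h1
  have h1 := (measure_congr (eventuallyEq_univ.mpr hconn)).trans measure_univ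
  exact (hbad.trans_lt hlt).ne h1

/-! ### Large values cover few sites -/

/-- The site `r` steps to the right of `u`. -/
def shift (u : ℤ × ℤ) (r : ℕ) : ℤ × ℤ := (u.1 + (r : ℤ), u.2)

theorem eq_of_shift_eq {u v : ℤ × ℤ} {r : ℕ} (h : shift u r = shift v r) : u = v := by
  simp only [shift, Prod.mk.injEq, add_left_inj] at h
  exact Prod.ext h.1 h.2

theorem one_add_sum_le_prod_one_add {ι : Type*} (s : Finset ι) (a : ι → ℝ≥0∞) :
    1 + ∑ i ∈ s, a i ≤ ∏ i ∈ s, (1 + a i) := by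
  classical
  induction s using Finset.induction_on with
  | empty => simp
  | insert i s hi ih =>
    rw [Finset.sum_insert hi, Finset.prod_insert hi, add_mul, one_mul]
    calc 1 + (a i + ∑ j ∈ s, a j) = (1 + ∑ j ∈ s, a j) + a i * 1 := by ring
      _ ≤ _ := add_le_add ih (mul_le_mul_right (le_trans (by simp) ih) _)

theorem prod_one_add_le_two {ι : Type*} (s : Finset ι) (a : ι → ℝ≥0∞)
    (h : ∑ i ∈ s, a i ≤ 2⁻¹) : ∏ i ∈ s, (1 + a i) ≤ 2 := by
  classical
  have h2 : 2 * ∑ i ∈ s, a i ≤ 1 := by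
    calc 2 * ∑ i ∈ s, a i ≤ 2 * 2⁻¹ := by gcongr
      _ = 1 := ENNReal.mul_inv_cancel (by simp) (by simp)
  suffices key : ∏ i ∈ s, (1 + a i) ≤ 1 + 2 * ∑ i ∈ s, a i by
    refine key.trans ((add_le_add_right h2 1).trans (by norm_num))
  clear h
  induction s using Finset.induction_on with
  | empty => simp
  | insert i s hi ih =>
    rw [Finset.sum_insert hi] at h2 ⊢
    rw [Finset.prod_insert hi]
    have h3 : 2 * ∑ j ∈ s, a j ≤ 1 := le_trans (by gcongr; exact le_add_self) h2
    calc (1 + a i) * ∏ j ∈ s, (1 + a j) ≤ (1 + a i) * (1 + 2 * ∑ j ∈ s, a j) := by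
          gcongr
          exact ih h3
      _ = 1 + 2 * ∑ j ∈ s, a j + a i * 1 + a i * (2 * ∑ j ∈ s, a j) := by ring
      _ ≤ 1 + 2 * ∑ j ∈ s, a j + a i * 1 + a i * 1 := by gcongr
      _ = 1 + 2 * (a i + ∑ j ∈ s, a j) := by ring

/-- Weight of a site `v` with value `y`: each site of `S` that `v` covers at distance `r` contributes
`L ^ (r + 1)`. -/
noncomputable def coverWeight (A : ℕ → Set ℝ) (L : ℝ≥0∞) (S : Finset (ℤ × ℤ)) (K : ℕ)
    (v : ℤ × ℤ) (y : ℝ) : ℝ≥0∞ :=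
  1 + ∑ p ∈ S ×ˢ Finset.range K, if shift p.1 p.2 = v then
    (A p.2).indicator (fun _ => L ^ (p.2 + 1)) y else 0

/-- If every site of `S` is covered, the total weight is at least `L ^ |S|`: a site `v` that covers
`m` sites of `S` covers one of them at distance at least `m - 1`. -/
theorem pow_card_le_prod_coverWeight {A : ℕ → Set ℝ} {L : ℝ≥0∞} (hL : 1 ≤ L)
    {S : Finset (ℤ × ℤ)} {K : ℕ} {x : ℤ × ℤ → ℝ}
    (h : ∀ s ∈ S, ∃ r < K, x (shift s r) ∈ A r) :
    L ^ S.card ≤ ∏ v ∈ (S ×ˢ Finset.range K).image (fun p => shift p.1 p.2),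
      coverWeight A L S K v (x v) := by
  classical
  choose! ρ hρK hρ using h
  have hmaps : ∀ s ∈ S, shift s (ρ s) ∈
      (S ×ˢ Finset.range K).image (fun p : (ℤ × ℤ) × ℕ => shift p.1 p.2) := fun s hs =>
    Finset.mem_image.mpr ⟨(s, ρ s), by simp [hs, hρK s hs], rfl⟩
  rw [Finset.card_eq_sum_card_fiberwise hmaps, ← Finset.prod_pow_eq_pow_sum]
  refine Finset.prod_le_prod' fun v _ => ?_
  set T := S.filter (fun s => shift s (ρ s) = v) with hT
  rcases T.eq_empty_or_nonempty with hemp | hne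
  · simp [hemp, coverWeight]
  obtain ⟨s, hs, hmax⟩ := T.exists_max_image ρ hne
  have hcard : T.card ≤ ρ s + 1 := by
    rw [← Finset.card_range (ρ s + 1)]
    refine Finset.card_le_card_of_injOn ρ (fun t ht => ?_) fun t ht t' ht' htt => ?_
    · simpa using Nat.lt_succ_of_le (hmax t ht)
    · have h1 := (Finset.mem_filter.mp ht).2
      have h2 := (Finset.mem_filter.mp ht').2
      rw [htt] at h1
      exact eq_of_shift_eq (h1.trans h2.symm)
  obtain ⟨hsS, hsv⟩ := Finset.mem_filter.mp hs
  calc L ^ T.card ≤ L ^ (ρ s + 1) := pow_le_pow_right₀ hL hcard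
    _ = if shift s (ρ s) = v then (A (ρ s)).indicator (fun _ => L ^ (ρ s + 1)) (x v) else 0 := by
        rw [if_pos hsv, Set.indicator_of_mem (hsv ▸ hρ s hsS)]
    _ ≤ ∑ p ∈ S ×ˢ Finset.range K, if shift p.1 p.2 = v then
        (A p.2).indicator (fun _ => L ^ (p.2 + 1)) (x v) else 0 :=
        Finset.single_le_sum (f := fun p : (ℤ × ℤ) × ℕ => if shift p.1 p.2 = v then
          (A p.2).indicator (fun _ => L ^ (p.2 + 1)) (x v) else 0) (fun _ _ => zero_le)
          (a := (s, ρ s)) (by simp [hsS, hρK s hsS])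
    _ ≤ coverWeight A L S K v (x v) := le_add_self

theorem measurable_coverWeight {A : ℕ → Set ℝ} (hA : ∀ r, MeasurableSet (A r)) (L : ℝ≥0∞)
    (S : Finset (ℤ × ℤ)) (K : ℕ) (v : ℤ × ℤ) : Measurable (coverWeight A L S K v) := by
  refine Measurable.add (f := fun _ : ℝ => (1 : ℝ≥0∞)) measurable_const
    (Finset.measurable_fun_sum _ fun p _ => ?_)
  split_ifs
  · exact measurable_const.indicator (hA _)
  · exact measurable_const

theorem lintegral_coverWeight_le {A : ℕ → Set ℝ} (hA : ∀ r, MeasurableSet (A r)) (L : ℝ≥0∞)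
    (S : Finset (ℤ × ℤ)) (K : ℕ) (v : ℤ × ℤ) (μ : Measure ℝ) [IsProbabilityMeasure μ] :
    ∫⁻ y, coverWeight A L S K v y ∂μ ≤ ∏ p ∈ S ×ˢ Finset.range K,
      if shift p.1 p.2 = v then 1 + L ^ (p.2 + 1) * μ (A p.2) else 1 := by
  unfold coverWeight
  rw [lintegral_add_left (f := fun _ : ℝ => (1 : ℝ≥0∞)) measurable_const, lintegral_finsetSum]
  · simp only [lintegral_const, measure_univ, mul_one]
    refine (one_add_sum_le_prod_one_add _ _).trans (le_of_eq (Finset.prod_congr rfl fun p _ => ?_))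
    split_ifs
    · rw [lintegral_indicator_const (hA _)]
    · simp
  · intro p _
    split_ifs
    · exact measurable_const.indicator (hA _)
    · exact measurable_const

/-- The Markov inequality for the product of the weights of all sites at distance less than `K` to the
right of `S`. -/
theorem measure_covered_le {P : Measure Ω} [IsProbabilityMeasure P] {μ : Measure ℝ}
    {X : ℤ × ℤ → Ω → ℝ} (hX : ∀ u, Measurable (X u)) (hind : iIndepFun X P)
    (hlaw : ∀ u, P.map (X u) = μ) {A : ℕ → Set ℝ} (hA : ∀ r, MeasurableSet (A r)) {L : ℝ≥0∞}
    (hL : 1 ≤ L) (hL' : L ≠ ∞) (hsum : ∑' r, L ^ (r + 1) * μ (A r) ≤ 2⁻¹)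
    (S : Finset (ℤ × ℤ)) (K : ℕ) :
    P {ω | ∀ s ∈ S, ∃ r < K, X (shift s r) ω ∈ A r} ≤ (2 * L⁻¹) ^ S.card := by
  classical
  have hμ : IsProbabilityMeasure μ := hlaw 0 ▸ Measure.isProbabilityMeasure_map (hX 0).aemeasurable
  set V := (S ×ˢ Finset.range K).image (fun p => shift p.1 p.2) with hV
  let φ : ℤ × ℤ → Ω → ℝ≥0∞ := fun v ω => coverWeight A L S K v (X v ω)
  have hφ : ∀ v, Measurable (φ v) := fun v => (measurable_coverWeight hA L S K v).comp (hX v)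
  have hint : ∫⁻ ω, ∏ v ∈ V, φ v ω ∂P ≤ 2 ^ S.card := by
    rw [lintegral_prod_eq_prod_lintegral_of_indepFun V φ
      (hind.comp _ fun v => measurable_coverWeight hA L S K v) hφ]
    calc ∏ v ∈ V, ∫⁻ ω, φ v ω ∂P
        ≤ ∏ v ∈ V, ∏ p ∈ S ×ˢ Finset.range K,
          if shift p.1 p.2 = v then 1 + L ^ (p.2 + 1) * μ (A p.2) else 1 := by
          refine Finset.prod_le_prod' fun v _ => ?_
          refine le_trans (le_of_eq ?_) (lintegral_coverWeight_le hA L S K v μ)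
          rw [← hlaw v, lintegral_map (measurable_coverWeight hA L S K v) (hX v)]
      _ = ∏ p ∈ S ×ˢ Finset.range K, (1 + L ^ (p.2 + 1) * μ (A p.2)) := by
          rw [Finset.prod_comm]
          refine Finset.prod_congr rfl fun p hp => ?_
          rw [Finset.prod_ite_eq, if_pos (Finset.mem_image_of_mem _ hp)]
      _ = ∏ s ∈ S, ∏ r ∈ Finset.range K, (1 + L ^ (r + 1) * μ (A r)) := Finset.prod_product _ _ _
      _ ≤ ∏ s ∈ S, 2 := Finset.prod_le_prod' fun s _ =>
          prod_one_add_le_two _ _ ((ENNReal.sum_le_tsum _).trans hsum)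
      _ = 2 ^ S.card := by simp
  have hmarkov := mul_meas_ge_le_lintegral (μ := P) (Finset.measurable_fun_prod V fun v _ => hφ v)
    (L ^ S.card)
  have hL0 : L ^ S.card ≠ 0 := pow_ne_zero _ (one_pos.trans_le hL).ne'
  calc P {ω | ∀ s ∈ S, ∃ r < K, X (shift s r) ω ∈ A r}
      ≤ P {ω | L ^ S.card ≤ ∏ v ∈ V, φ v ω} :=
        measure_mono fun ω hω => pow_card_le_prod_coverWeight (x := fun v => X v ω) hL hω
    _ ≤ 2 ^ S.card / L ^ S.card := by
        rw [ENNReal.le_div_iff_mul_le (Or.inl hL0) (Or.inl (ENNReal.pow_ne_top hL')), mul_comm]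
        exact hmarkov.trans hint
    _ = (2 * L⁻¹) ^ S.card := by rw [mul_pow, ← ENNReal.inv_pow, div_eq_mul_inv]

/-- The set of sites `u` that are covered, for some `r`, by the site `r` steps to the right, because
its value lies in `A r`. -/
theorem sparse_covered {P : Measure Ω} [IsProbabilityMeasure P] {μ : Measure ℝ}
    {X : ℤ × ℤ → Ω → ℝ} (hX : ∀ u, Measurable (X u)) (hind : iIndepFun X P)
    (hlaw : ∀ u, P.map (X u) = μ) {A : ℕ → Set ℝ} (hA : ∀ r, MeasurableSet (A r)) {L : ℝ≥0∞}
    (hL : 1 ≤ L) (hL' : L ≠ ∞) (hsum : ∑' r, L ^ (r + 1) * μ (A r) ≤ 2⁻¹) :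
    Sparse P (fun ω => {u | ∃ r, X (shift u r) ω ∈ A r}) (2 * L⁻¹) := by
  intro S
  have hmono : Monotone fun K : ℕ => {ω | ∀ s ∈ S, ∃ r < K, X (shift s r) ω ∈ A r} := by
    intro K K' hK ω hω s hs
    obtain ⟨r, hr, h⟩ := hω s hs
    exact ⟨r, hr.trans_le hK, h⟩
  have hsub : {ω | (S : Set (ℤ × ℤ)) ⊆ {u | ∃ r, X (shift u r) ω ∈ A r}} ⊆
      ⋃ K : ℕ, {ω | ∀ s ∈ S, ∃ r < K, X (shift s r) ω ∈ A r} := by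
    intro ω hω
    have : ∀ s ∈ S, ∃ r, X (shift s r) ω ∈ A r := fun s hs => hω hs
    choose! ρ hρ using this
    exact Set.mem_iUnion.mpr ⟨S.sup ρ + 1, fun s hs =>
      ⟨ρ s, Nat.lt_succ_of_le (Finset.le_sup hs), hρ s hs⟩⟩
  refine (measure_mono hsub).trans ?_
  rw [hmono.measure_iUnion]
  exact iSup_le fun K => measure_covered_le hX hind hlaw hA hL hL' hsum S K

/-! ### Exponential tails: the shadow is sparse -/

theorem exists_large_of_mem_shadow {x : ℤ × ℤ → ℝ} {κ : ℝ} (hκ : 0 < κ) {u : ℤ × ℤ}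
    (hu : u ∈ shadow x (4 * κ)) : ∃ r : ℕ, κ * max 1 (r : ℝ) < |x (shift u r)| := by
  have h1 : ((2 * κ : ℝ) : EReal) < alpha x u :=
    lt_of_lt_of_le (EReal.coe_lt_coe_iff.mpr (by linarith)) hu
  simp only [alpha, lt_iSup_iff, EReal.coe_lt_coe_iff] at h1
  obtain ⟨r, hr, h⟩ := h1
  have hr1 : (1 : ℝ) ≤ r := by exact_mod_cast hr
  rw [lt_div_iff₀ (by linarith)] at h
  by_cases hv : κ * r < |x (shift u r)|
  · exact ⟨r, by rwa [max_eq_right hr1]⟩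
  · refine ⟨0, ?_⟩
    have h2 : shift u 0 = u := by simp [shift]
    have h3 : x (u.1 + (r : ℤ), u.2) ≤ κ * r := (le_abs_self _).trans (not_lt.mp hv)
    have h4 := neg_abs_le (x u)
    rw [h2]
    simp only [Nat.cast_zero, zero_le_one, max_eq_left]
    nlinarith

/-- With `κ` large, the term of index `r` is at most `2 ^ (-(r + 2))`. -/
theorem exists_tsum_le {μ : Measure ℝ} [IsProbabilityMeasure μ] (hμ : HasExponentialTails μ)
    {L : ℝ} (hL : 1 ≤ L) : ∃ κ : ℝ, 0 < κ ∧
      ∑' r : ℕ, ENNReal.ofReal L ^ (r + 1) * μ {y | κ * max 1 (r : ℝ) < |y|} ≤ 2⁻¹ := by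
  obtain ⟨c, C, hc, hC, htail⟩ := hμ
  -- Since `(r + 1) / 2 ≤ max 1 r`, the tail at `κ * max 1 r` is at most `C * z ^ (r + 1)`.
  set z : ℝ := (4 * L * (C + 1))⁻¹ with hz
  have hz0 : 0 < z := by positivity
  have hz1 : z < 1 := inv_lt_one_of_one_lt₀ (by nlinarith)
  have hκ : 0 < -(2 / c) * Real.log z := by
    have := Real.log_neg hz0 hz1
    have : 0 < 2 / c := by positivity
    nlinarith
  refine ⟨-(2 / c) * Real.log z, hκ, ?_⟩
  set κ := -(2 / c) * Real.log z with hκdef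
  have hexp : Real.exp (-c * κ / 2) = z := by
    have : -c * κ / 2 = Real.log z := by rw [hκdef]; field_simp
    rw [this, Real.exp_log hz0]
  have hterm : ∀ r : ℕ, ENNReal.ofReal L ^ (r + 1) * μ {y | κ * max 1 (r : ℝ) < |y|} ≤
      2⁻¹ ^ (2 + r) := by
    intro r
    have hset : {y : ℝ | κ * max 1 (r : ℝ) < |y|} =
        (Set.Icc (-(κ * max 1 (r : ℝ))) (κ * max 1 (r : ℝ)))ᶜ := by
      ext y
      simp only [Set.mem_ofPred_eq, Set.mem_compl_iff, Set.mem_Icc, ← abs_le, not_le]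
    have h1 := htail (κ * max 1 (r : ℝ)) (by positivity)
    have h2 : Real.exp (-c * (κ * max 1 (r : ℝ))) ≤ z ^ (r + 1) := by
      rw [← hexp, ← Real.exp_nat_mul]
      apply Real.exp_le_exp.mpr
      have h3 : ((r : ℝ) + 1) / 2 ≤ max 1 (r : ℝ) := by
        have := le_max_left 1 (r : ℝ)
        have := le_max_right 1 (r : ℝ)
        linarith
      have h4 : 0 < c * κ := by positivity
      push_cast
      nlinarith
    have h5 : L ^ (r + 1) * (C * Real.exp (-c * (κ * max 1 (r : ℝ)))) ≤ 2⁻¹ ^ (2 + r) := by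
      have h6 : L * z = (4 * (C + 1))⁻¹ := by rw [hz]; field_simp
      have h7 : (C + 1)⁻¹ ^ (r + 1) ≤ (C + 1)⁻¹ := by
        rw [pow_succ]
        exact mul_le_of_le_one_left (by positivity)
          (pow_le_one₀ (by positivity) (inv_le_one_of_one_le₀ (by linarith)))
      calc L ^ (r + 1) * (C * Real.exp (-c * (κ * max 1 (r : ℝ))))
          ≤ L ^ (r + 1) * (C * z ^ (r + 1)) := by gcongr
        _ = C * (4⁻¹ ^ (r + 1) * (C + 1)⁻¹ ^ (r + 1)) := by
            rw [← mul_pow, ← mul_inv, ← h6]; ring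
        _ ≤ C * (4⁻¹ ^ (r + 1) * (C + 1)⁻¹) := by gcongr
        _ = (C / (C + 1)) * 4⁻¹ ^ (r + 1) := by ring
        _ ≤ 1 * 4⁻¹ ^ (r + 1) := by
            gcongr
            rw [div_le_one (by linarith)]; linarith
        _ = 2⁻¹ ^ (2 * (r + 1)) := by rw [pow_mul]; norm_num
        _ ≤ 2⁻¹ ^ (2 + r) := pow_le_pow_of_le_one (by norm_num) (by norm_num) (by omega)
    rw [hset, ← ENNReal.ofReal_pow (by linarith), ← ofReal_measureReal,
      ← ENNReal.ofReal_mul (by positivity)]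
    calc _ ≤ ENNReal.ofReal (2⁻¹ ^ (2 + r)) := by
          refine ENNReal.ofReal_le_ofReal (le_trans ?_ h5)
          gcongr
      _ = 2⁻¹ ^ (2 + r) := by
          rw [ENNReal.ofReal_pow (by norm_num), ENNReal.ofReal_inv_of_pos (by norm_num)]
          norm_num
  refine (ENNReal.tsum_le_tsum hterm).trans ((tsum_geometric_tail_le le_rfl 2).trans (le_of_eq ?_))
  rw [pow_two, ← mul_assoc, ENNReal.mul_inv_cancel (by simp) (by simp), one_mul]

theorem exists_sparse_shadow {P : Measure Ω} [IsProbabilityMeasure P] {μ : Measure ℝ}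
    {X : ℤ × ℤ → Ω → ℝ} (hX : ∀ u, Measurable (X u)) (hind : iIndepFun X P)
    (hlaw : ∀ u, P.map (X u) = μ) (hμ : HasExponentialTails μ) :
    ∃ ℓ : ℝ, Sparse P (fun ω => shadow (fun u => X u ω) ℓ) ((1152⁻¹ : ℝ≥0∞) ^ 2) := by
  have hprob : IsProbabilityMeasure μ :=
    hlaw 0 ▸ Measure.isProbabilityMeasure_map (hX 0).aemeasurable
  obtain ⟨κ, hκ, hsum⟩ := exists_tsum_le hμ (L := 2 * 1152 ^ 2) (by norm_num)
  have hS := sparse_covered hX hind hlaw (A := fun r => {y | κ * max 1 (r : ℝ) < |y|})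
    (fun r => measurableSet_lt measurable_const measurable_id.abs)
    (by rw [ENNReal.one_le_ofReal]; norm_num) ENNReal.ofReal_ne_top hsum
  have hconst : 2 * (ENNReal.ofReal (2 * 1152 ^ 2))⁻¹ = (1152⁻¹ : ℝ≥0∞) ^ 2 := by
    rw [← ENNReal.toReal_eq_toReal_iff' (by finiteness) (by finiteness)]
    rw [ENNReal.toReal_mul, ENNReal.toReal_inv, ENNReal.toReal_ofReal (by norm_num)]
    simp
    norm_num
  refine ⟨4 * κ, fun S => ?_⟩
  rw [← hconst]
  refine (measure_mono fun ω hω => ?_).trans (hS S)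
  exact fun s hs => exists_large_of_mem_shadow hκ (hω hs)

/-! ### Records of an exchangeable sequence -/

theorem measure_eval_eq_eval {ι : Type*} (μ : Measure ℝ) [IsProbabilityMeasure μ] [NullSingletonClass μ] {i j : ι}
    (h : i ≠ j) : Measure.infinitePi (fun _ : ι => μ) {x | x i = x j} = 0 := by
  have hd : MeasurableSet {p : ℝ × ℝ | p.1 = p.2} := measurableSet_eq_fun measurable_fst
    measurable_snd
  have h1 := Measure.infinitePi_map_eval_prod (P := fun _ : ι => μ) h
  have h2 : (μ.prod μ) {p : ℝ × ℝ | p.1 = p.2} = 0 := by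
    rw [Measure.measure_prod_null hd]
    refine Eventually.of_forall fun a => ?_
    have : Prod.mk a ⁻¹' {p : ℝ × ℝ | p.1 = p.2} = {a} := by
      ext b
      simp [eq_comm]
    simp [this]
  rw [← h1, Measure.map_apply (by fun_prop) hd] at h2
  exact h2

section Chain

variable {ι : Type*} [LinearOrder ι]

/-- The configurations in which, up to the tolerance `ε`, the value at each site of `A` is at least
all later values in `A ∪ W`. -/
def chain (A W : Finset ι) (ε : ℝ) : Set (ι → ℝ) :=
  {x | ∀ i ∈ A, ∀ j ∈ A ∪ W, i < j → x j ≤ x i + ε}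

theorem measurableSet_chain [Finite ι] (A W : Finset ι) (ε : ℝ) : MeasurableSet (chain A W ε) := by
  refine IsClosed.measurableSet ?_
  simp only [chain, Set.ofPred_forall]
  exact isClosed_iInter fun i => isClosed_iInter fun _ => isClosed_iInter fun j =>
    isClosed_iInter fun _ => isClosed_iInter fun _ =>
      isClosed_le (continuous_apply j) ((continuous_apply i).add continuous_const)

/-- For i.i.d. continuous variables, the chance that the values on `A` are successive maxima of the
sequence, all of them above those on `W`, is at most `|W| ^ (-|A|)`: exchanging the last site of `A`
with those of `W` produces disjoint events of equal probability. -/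
theorem card_pow_mul_measure_chain_le [Finite ι] (μ : Measure ℝ) [IsProbabilityMeasure μ]
    [NullSingletonClass μ] (A W : Finset ι) (hAW : ∀ i ∈ A, ∀ w ∈ W, i < w) :
    (W.card : ℝ≥0∞) ^ A.card * Measure.infinitePi (fun _ : ι => μ) (chain A W 0) ≤ 1 := by
  induction A using Finset.induction_on_max generalizing W with
  | empty => simpa using prob_le_one
  | insert a A hA ih =>
    set ν := Measure.infinitePi (fun _ : ι => μ)
    -- `E w` is the chain event with the roles of `a` and `w` exchanged. For `w ∈ insert a W` these
    -- events are disjoint up to null sets and lie in the chain event of `A` and `insert a W`.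
    have haA : a ∉ A := fun h => lt_irrefl a (hA a h)
    have haW : a ∉ W := fun h => lt_irrefl a (hAW a (by simp) a h)
    have ih' := ih (insert a W) fun i hi w hw => by
      rcases Finset.mem_insert.mp hw with rfl | hw
      · exact hA i hi
      · exact hAW i (by simp [hi]) w hw
    let E : ι → Set (ι → ℝ) := fun w => (fun x i => x (Equiv.swap a w i)) ⁻¹' chain (insert a A) W 0
    have hEmeas : ∀ w, MeasurableSet (E w) := fun w =>
      (measurableSet_chain _ _ _).preimage (by fun_prop)
    have hEν : ∀ w, ν (E w) = ν (chain (insert a A) W 0) := by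
      intro w
      rw [← Measure.map_apply (by fun_prop) (measurableSet_chain _ _ _),
        Measure.map_infinitePi_infinitePi_of_inj (Equiv.swap a w).injective]
    have hle : ∀ w ∈ insert a W, ∀ w' ∈ insert a W, w ≠ w' → ∀ x ∈ E w, x w' ≤ x w := by
      intro w hw w' hw' hne x hx
      have hk : ∀ k ∈ W, x (Equiv.swap a w k) ≤ x w := fun k hk => by
        simpa using hx a (by simp) k (by simp [hk]) (hAW a (by simp) k hk)
      by_cases h : w' = a
      · subst h
        simpa using hk w ((Finset.mem_insert.mp hw).resolve_left hne)
      · simpa [Equiv.swap_apply_of_ne_of_ne h hne.symm] using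
          hk w' ((Finset.mem_insert.mp hw').resolve_left h)
    have hdisj : Set.Pairwise (↑(insert a W)) (Function.onFun (AEDisjoint ν) E) := by
      intro w hw w' hw' hne
      refine measure_mono_null (fun x hx => ?_) (measure_eval_eq_eval μ hne)
      exact le_antisymm (hle w' hw' w hw hne.symm x hx.2) (hle w hw w' hw' hne x hx.1)
    have hsub : (⋃ w ∈ insert a W, E w) ⊆ chain A (insert a W) 0 := by
      intro x hx
      obtain ⟨w, hw, hx⟩ := Set.mem_iUnion₂.mp hx
      have hfix : ∀ i ∈ A, Equiv.swap a w i = i := by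
        intro i hi
        refine Equiv.swap_apply_of_ne_of_ne (hA i hi).ne ?_
        rcases Finset.mem_insert.mp hw with rfl | hw
        · exact (hA i hi).ne
        · exact (hAW i (by simp [hi]) w hw).ne
      intro i hi j hj hij
      have hmem : Equiv.swap a w j ∈ insert a A ∪ W ∧ i < Equiv.swap a w j := by
        rcases Finset.mem_union.mp hj with hj | hj
        · rw [hfix j hj]
          exact ⟨by simp [hj], hij⟩
        · have h1 : Equiv.swap a w j ∈ insert a W := by
            rcases eq_or_ne j a with rfl | hja
            · simpa using hw
            rcases eq_or_ne j w with rfl | hjw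
            · simp
            · rwa [Equiv.swap_apply_of_ne_of_ne hja hjw]
          rcases Finset.mem_insert.mp h1 with h2 | h2
          · rw [h2]
            exact ⟨by simp, hA i hi⟩
          · exact ⟨by simp [h2], hAW i (by simp [hi]) _ h2⟩
      simpa [hfix i hi] using hx i (by simp [hi]) (Equiv.swap a w j) hmem.1 hmem.2
    have hsum : ((insert a W).card : ℝ≥0∞) * ν (chain (insert a A) W 0) ≤
        ν (chain A (insert a W) 0) := by
      calc ((insert a W).card : ℝ≥0∞) * ν (chain (insert a A) W 0)
          = ∑ w ∈ insert a W, ν (E w) := by simp [hEν]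
        _ = ν (⋃ w ∈ insert a W, E w) :=
            (measure_biUnion_finset₀ hdisj fun w _ => (hEmeas w).nullMeasurableSet).symm
        _ ≤ _ := measure_mono hsub
    have hcard : (W.card : ℝ≥0∞) ≤ (insert a W).card := by
      exact_mod_cast Finset.card_le_card (Finset.subset_insert a W)
    calc (W.card : ℝ≥0∞) ^ (insert a A).card * ν (chain (insert a A) W 0)
        ≤ ((insert a W).card : ℝ≥0∞) ^ (insert a A).card * ν (chain (insert a A) W 0) := by gcongr
      _ = ((insert a W).card : ℝ≥0∞) ^ A.card *
            (((insert a W).card : ℝ≥0∞) * ν (chain (insert a A) W 0)) := by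
          rw [Finset.card_insert_of_notMem haA, pow_succ, mul_assoc]
      _ ≤ ((insert a W).card : ℝ≥0∞) ^ A.card * ν (chain A (insert a W) 0) := by gcongr
      _ ≤ 1 := ih'

/-- A positive tolerance changes the probability of a chain by little, uniformly over the finitely
many `A`. -/
theorem exists_measure_chain_le [Finite ι] (μ : Measure ℝ) [IsProbabilityMeasure μ]
    [NullSingletonClass μ] (W : Finset ι) (hW : W.Nonempty) :
    ∃ ε > 0, ∀ A : Finset ι, (∀ i ∈ A, ∀ w ∈ W, i < w) →
      Measure.infinitePi (fun _ : ι => μ) (chain A W ε) ≤ (2 * (W.card : ℝ≥0∞)⁻¹) ^ A.card := by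
  set ν := Measure.infinitePi (fun _ : ι => μ)
  have hW0 : (W.card : ℝ≥0∞) ≠ 0 := by exact_mod_cast hW.card_pos.ne'
  have hev : ∀ A : Finset ι, ∀ᶠ ε in nhdsWithin (0 : ℝ) (Set.Ioi 0),
      (∀ i ∈ A, ∀ w ∈ W, i < w) → ν (chain A W ε) ≤ (2 * (W.card : ℝ≥0∞)⁻¹) ^ A.card := by
    intro A
    by_cases hAW : ∀ i ∈ A, ∀ w ∈ W, i < w
    swap
    · exact Eventually.of_forall fun ε h => (hAW h).elim
    rcases A.eq_empty_or_nonempty with rfl | hA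
    · exact Eventually.of_forall fun ε _ => by simpa using prob_le_one
    have hlim : Tendsto (ν ∘ fun ε => chain A W ε) (nhdsWithin (0 : ℝ) (Set.Ioi 0))
        (nhds (ν (⋂ ε > (0 : ℝ), chain A W ε))) :=
      tendsto_measure_biInter_gt (fun ε _ => (measurableSet_chain A W ε).nullMeasurableSet)
        (fun ε ε' _ h x hx i hi j hj hij => (hx i hi j hj hij).trans (by gcongr))
        ⟨1, one_pos, measure_ne_top _ _⟩
    have hinter : (⋂ ε > (0 : ℝ), chain A W ε) ⊆ chain A W 0 := by
      intro x hx i hi j hj hij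
      rw [add_zero]
      exact le_of_forall_pos_le_add fun ε hε => Set.mem_iInter₂.mp hx ε hε i hi j hj hij
    have hlt : ν (⋂ ε > (0 : ℝ), chain A W ε) < (2 * (W.card : ℝ≥0∞)⁻¹) ^ A.card := by
      have h1 : ν (chain A W 0) ≤ (W.card : ℝ≥0∞)⁻¹ ^ A.card := by
        rw [← ENNReal.inv_pow, ENNReal.le_inv_iff_mul_le, mul_comm]
        exact card_pow_mul_measure_chain_le μ A W hAW
      refine (measure_mono hinter).trans_lt (h1.trans_lt ?_)
      have h2 : (W.card : ℝ≥0∞)⁻¹ < 2 * (W.card : ℝ≥0∞)⁻¹ := by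
        rw [two_mul]
        exact ENNReal.lt_add_right (by simpa using hW0) (by simp)
      exact ENNReal.pow_lt_pow_left hA.card_pos.ne' h2
    exact (hlim.eventually_lt_const hlt).mono fun ε h _ => h.le
  obtain ⟨ε, hε, h0⟩ := ((eventually_all.mpr hev).and self_mem_nhdsWithin).exists
  exact ⟨ε, h0, hε⟩

end Chain

/-! ### Independent blocks in the rows of the lattice -/

/-- The `i`-th site of the block of `2 * R` consecutive sites of row `k.2` that starts at abscissa
`(2 * k.1 + p) * R`. -/
def blockSite (R : ℕ) (p : ℤ) (k : ℤ × ℤ) (i : Fin (R + R)) : ℤ × ℤ :=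
  ((2 * k.1 + p) * R + (i : ℕ), k.2)

theorem blockSite_injective (R : ℕ) (p : ℤ) :
    Function.Injective fun q : (ℤ × ℤ) × Fin (R + R) => blockSite R p q.1 q.2 := by
  rintro ⟨⟨b, y⟩, i⟩ ⟨⟨b', y'⟩, i'⟩ h
  simp only [blockSite, Prod.mk.injEq] at h
  obtain ⟨h1, rfl⟩ := h
  have hi : ((i : ℕ) : ℤ) < R + R := by exact_mod_cast i.2
  have hi' : ((i' : ℕ) : ℤ) < R + R := by exact_mod_cast i'.2
  have hb : b = b' := by
    rcases lt_trichotomy b b' with h | h | h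
    · nlinarith
    · exact h
    · nlinarith
  subst hb
  have : (i : ℕ) = i' := by exact_mod_cast add_left_cancel h1
  rw [Fin.ext this]

theorem exists_blockSite_eq {R : ℕ} (hR : 0 < R) (u : ℤ × ℤ) :
    ∃ p, (p = 0 ∨ p = 1) ∧ ∃ k, ∃ i : Fin R, blockSite R p k (Fin.castAdd R i) = u := by
  have hR' : (0 : ℤ) < R := by exact_mod_cast hR
  have hm0 := Int.emod_nonneg u.1 hR'.ne'
  have hm1 := Int.emod_lt_of_pos u.1 hR'
  refine ⟨u.1 / R % 2, by omega, (u.1 / R / 2, u.2), ⟨(u.1 % R).toNat, by omega⟩, ?_⟩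
  have h1 := Int.mul_ediv_add_emod u.1 R
  have h2 := Int.mul_ediv_add_emod (u.1 / R) 2
  simp only [blockSite, Fin.val_castAdd, Int.toNat_of_nonneg hm0, h2]
  exact Prod.ext (by simp only; linarith) rfl

/-- The values on disjoint blocks form an i.i.d. family of i.i.d. families. -/
theorem map_block_eq {P : Measure Ω} [IsProbabilityMeasure P] {μ : Measure ℝ}
    {X : ℤ × ℤ → Ω → ℝ} (hX : ∀ u, Measurable (X u)) (hind : iIndepFun X P)
    (hlaw : ∀ u, P.map (X u) = μ) [IsProbabilityMeasure μ] {κ ι : Type*} {f : κ → ι → ℤ × ℤ}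
    (hf : Function.Injective fun q : κ × ι => f q.1 q.2) :
    P.map (fun ω k i => X (f k i) ω) =
      Measure.infinitePi fun _ : κ => Measure.infinitePi fun _ : ι => μ := by
  have h1 := (hind.precomp hf).map_fun_eq_infinitePi_map fun q => hX _
  simp only [hlaw] at h1
  rw [← Measure.infinitePi_map_curry (fun _ _ => μ), ← h1, Measure.map_map (by fun_prop)
    (measurable_pi_lambda _ fun q => hX _)]
  rfl

theorem measure_blocks_eq {P : Measure Ω} [IsProbabilityMeasure P] {μ : Measure ℝ}
    {X : ℤ × ℤ → Ω → ℝ} (hX : ∀ u, Measurable (X u)) (hind : iIndepFun X P)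
    (hlaw : ∀ u, P.map (X u) = μ) [IsProbabilityMeasure μ] {κ ι : Type*} {f : κ → ι → ℤ × ℤ}
    (hf : Function.Injective fun q : κ × ι => f q.1 q.2) (K : Finset κ) {D : κ → Set (ι → ℝ)}
    (hD : ∀ k, MeasurableSet (D k)) :
    P {ω | ∀ k ∈ K, (fun i => X (f k i) ω) ∈ D k} =
      ∏ k ∈ K, Measure.infinitePi (fun _ : ι => μ) (D k) := by
  have hmeas : Measurable fun ω k i => X (f k i) ω :=
    measurable_pi_lambda _ fun k => measurable_pi_lambda _ fun i => hX _
  rw [← Measure.infinitePi_pi (fun _ : κ => Measure.infinitePi fun _ : ι => μ)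
    (fun k _ => hD k), ← map_block_eq hX hind hlaw hf, Measure.map_apply hmeas
    (MeasurableSet.pi K.countable_toSet fun k _ => hD k)]
  rfl

/-! ### Continuous laws: the lit set is sparse -/

theorem le_of_mem_lit {x : ℤ × ℤ → ℝ} {ℓ : ℝ} {u : ℤ × ℤ} (hu : u ∈ lit x ℓ) {r : ℕ}
    (hr : 1 ≤ r) : x (shift u r) ≤ x u + ℓ * r := by
  have h1 : (((x (u.1 + (r : ℤ), u.2) - x u) / (r : ℝ) : ℝ) : EReal) ≤ ℓ :=
    (le_iSup₂_of_le (f := fun (r : ℕ) (_ : 1 ≤ r) =>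
      (((x (u.1 + (r : ℤ), u.2) - x u) / (r : ℝ) : ℝ) : EReal)) r hr le_rfl).trans hu
  rw [EReal.coe_le_coe_iff, div_le_iff₀ (by exact_mod_cast hr)] at h1
  simp only [shift]
  linarith

/-- The sites of `T` lie in the first halves of the blocks of phase `p`. Their membership in the lit
set forces, in each block, a chain above the second half of the block; the blocks are disjoint, hence
independent. -/
theorem measure_subset_lit_le {P : Measure Ω} [IsProbabilityMeasure P] {μ : Measure ℝ}
    {X : ℤ × ℤ → Ω → ℝ} (hX : ∀ u, Measurable (X u)) (hind : iIndepFun X P)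
    (hlaw : ∀ u, P.map (X u) = μ) [IsProbabilityMeasure μ] {R : ℕ} {ε ℓ : ℝ} (hℓ : 0 ≤ ℓ)
    (hℓε : ℓ * (R + R) ≤ ε) {δ : ℝ≥0∞}
    (hδ : ∀ A : Finset (Fin (R + R)), (∀ i ∈ A, ∀ w ∈ Finset.univ.map (Fin.natAddEmb R), i < w) →
      Measure.infinitePi (fun _ : Fin (R + R) => μ)
        (chain A (Finset.univ.map (Fin.natAddEmb R)) ε) ≤ δ ^ A.card)
    (p : ℤ) (T : Finset ((ℤ × ℤ) × Fin R)) :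
    P {ω | ∀ q ∈ T, blockSite R p q.1 (Fin.castAdd R q.2) ∈ lit (fun u => X u ω) ℓ} ≤
      δ ^ T.card := by
  classical
  let W : Finset (Fin (R + R)) := Finset.univ.map (Fin.natAddEmb R)
  let A : ℤ × ℤ → Finset (Fin (R + R)) := fun k =>
    (T.filter fun q => q.1 = k).image fun q => Fin.castAdd R q.2
  have hA : ∀ k, (A k).card = (T.filter fun q => q.1 = k).card := by
    intro k
    refine Finset.card_image_of_injOn fun q hq q' hq' h => ?_
    have h1 := (Finset.mem_filter.mp hq).2
    have h2 := (Finset.mem_filter.mp hq').2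
    exact Prod.ext (h1.trans h2.symm) (Fin.castAdd_injective R R h)
  have hAW : ∀ k, ∀ i ∈ A k, ∀ w ∈ W, i < w := by
    intro k i hi w hw
    obtain ⟨q, -, rfl⟩ := Finset.mem_image.mp hi
    obtain ⟨j, -, rfl⟩ := Finset.mem_map.mp hw
    simp only [Fin.lt_def, Fin.val_castAdd, Fin.natAddEmb_apply, Fin.val_natAdd]
    omega
  calc P {ω | ∀ q ∈ T, blockSite R p q.1 (Fin.castAdd R q.2) ∈ lit (fun u => X u ω) ℓ}
      ≤ P {ω | ∀ k ∈ T.image Prod.fst,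
          (fun i => X (blockSite R p k i) ω) ∈ chain (A k) W ε} := by
        refine measure_mono fun ω hω k _ i hi j _ hij => ?_
        obtain ⟨q, hq, rfl⟩ := Finset.mem_image.mp hi
        obtain ⟨hqT, rfl⟩ := Finset.mem_filter.mp hq
        have hlt : q.2.val < j.val := hij
        have hsite : blockSite R p q.1 j =
            shift (blockSite R p q.1 (Fin.castAdd R q.2)) (j - q.2.val) := by
          refine Prod.ext ?_ rfl
          simp only [blockSite, shift, Fin.val_castAdd]
          push_cast [hlt.le]
          ring
        have h1 := le_of_mem_lit (hω q hqT) (r := j - q.2.val) (by omega)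
        rw [← hsite] at h1
        have h2 : ((j - q.2.val : ℕ) : ℝ) ≤ R + R := by
          have := j.2
          exact_mod_cast (by omega : j.val - q.2.val ≤ R + R)
        have h3 := mul_le_mul_of_nonneg_left h2 hℓ
        simp only
        linarith
    _ = ∏ k ∈ T.image Prod.fst, Measure.infinitePi (fun _ => μ) (chain (A k) W ε) :=
        measure_blocks_eq hX hind hlaw (blockSite_injective R p) _ fun k => measurableSet_chain _ _ _
    _ ≤ ∏ k ∈ T.image Prod.fst, δ ^ (A k).card := Finset.prod_le_prod' fun k _ => hδ _ (hAW k)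
    _ = δ ^ T.card := by
        simp only [hA]
        rw [Finset.prod_pow_eq_pow_sum, ← Finset.card_eq_sum_card_image]

theorem exists_sparse_lit {P : Measure Ω} [IsProbabilityMeasure P] {μ : Measure ℝ}
    {X : ℤ × ℤ → Ω → ℝ} (hX : ∀ u, Measurable (X u)) (hind : iIndepFun X P)
    (hlaw : ∀ u, P.map (X u) = μ) [NullSingletonClass μ] :
    ∃ ℓ : ℝ, 0 < ℓ ∧ Sparse P (fun ω => lit (fun u => X u ω) ℓ) ((1152⁻¹ : ℝ≥0∞) ^ 2) := by
  classical
  have hprob : IsProbabilityMeasure μ :=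
    hlaw 0 ▸ Measure.isProbabilityMeasure_map (hX 0).aemeasurable
  -- This `R` makes `2 / R = t ^ 2`. Keeping it opaque prevents evaluation of `Fin (R + R)`.
  obtain ⟨R, hR⟩ : ∃ R : ℕ, R = 2 * 1152 ^ 4 := ⟨_, rfl⟩
  have hR0 : 0 < R := by rw [hR]; norm_num
  have hne : (Finset.univ.map (Fin.natAddEmb R) : Finset (Fin (R + R))).Nonempty :=
    ⟨Fin.natAddEmb R ⟨0, hR0⟩, Finset.mem_map_of_mem _ (Finset.mem_univ _)⟩
  obtain ⟨ε, hε, hchain⟩ := exists_measure_chain_le μ _ hne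
  have hRpos : (0 : ℝ) < R := by exact_mod_cast hR0
  set t : ℝ≥0∞ := (1152⁻¹ : ℝ≥0∞) ^ 2 with ht
  have hconst : 2 * ((Finset.univ.map (Fin.natAddEmb R) : Finset (Fin (R + R))).card : ℝ≥0∞)⁻¹ =
      t ^ 2 := by
    rw [Finset.card_map, Finset.card_univ, Fintype.card_fin, hR, ht,
      ← ENNReal.toReal_eq_toReal_iff' (by finiteness) (by finiteness)]
    simp
    norm_num
  rw [hconst] at hchain
  have ht1 : t ≤ 1 := pow_le_one₀ zero_le (by simp)
  refine ⟨ε / (R + R), by positivity, fun S => ?_⟩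
  -- `T p` lists the sites of `S` that are in the first half of a block of phase `p`; one of `T 0`
  -- and `T 1` accounts for at least half of `S`.
  let T : ℤ → Finset ((ℤ × ℤ) × Fin R) := fun p =>
    S.preimage (fun q => blockSite R p q.1 (Fin.castAdd R q.2)) (by
      intro q _ q' _ h
      have := blockSite_injective R p (a₁ := (q.1, Fin.castAdd R q.2))
        (a₂ := (q'.1, Fin.castAdd R q'.2)) h
      simp only [Prod.mk.injEq] at this
      exact Prod.ext this.1 (Fin.castAdd_injective R R this.2))
  have hT : ∀ p, P {ω | (S : Set (ℤ × ℤ)) ⊆ lit (fun u => X u ω) (ε / (R + R))} ≤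
      t ^ (2 * (T p).card) := by
    intro p
    rw [pow_mul]
    refine le_trans (measure_mono fun ω hω => ?_) (measure_subset_lit_le hX hind hlaw
      (ℓ := ε / (R + R)) (by positivity) (div_mul_cancel₀ _ (by positivity)).le hchain p (T p))
    intro q hq
    have hqS := Finset.mem_preimage.mp (show q ∈ T p from hq)
    exact hω hqS
  have hcover : S ⊆ (T 0).image (fun q => blockSite R 0 q.1 (Fin.castAdd R q.2)) ∪
      (T 1).image (fun q => blockSite R 1 q.1 (Fin.castAdd R q.2)) := by
    intro u hu
    obtain ⟨p, hp, k, i, rfl⟩ := exists_blockSite_eq hR0 u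
    rcases hp with rfl | rfl
    · exact Finset.mem_union_left _ (Finset.mem_image.mpr ⟨(k, i), Finset.mem_preimage.mpr hu, rfl⟩)
    · exact Finset.mem_union_right _
        (Finset.mem_image.mpr ⟨(k, i), Finset.mem_preimage.mpr hu, rfl⟩)
  have hcard : S.card ≤ (T 0).card + (T 1).card :=
    (Finset.card_le_card hcover).trans ((Finset.card_union_le _ _).trans
      (add_le_add Finset.card_image_le Finset.card_image_le))
  rcases le_total (T 0).card (T 1).card with h | h
  · exact (hT 1).trans (pow_le_pow_of_le_one zero_le ht1 (by omega))
  · exact (hT 0).trans (pow_le_pow_of_le_one zero_le ht1 (by omega))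

theorem HasLebesgueDensity.nullSingletonClass {μ : Measure ℝ} [IsFiniteMeasure μ]
    (h : HasLebesgueDensity μ) : NullSingletonClass μ := by
  obtain ⟨φ, -, hφ⟩ := h
  refine ⟨fun a => ?_⟩
  have := hφ a a le_rfl
  rwa [Set.Icc_self, intervalIntegral.integral_same, measureReal_eq_zero_iff] at this

/-! ### Conclusion -/

theorem ConnectsToInfinity.mono {A B : Set (ℤ × ℤ)} {u : ℤ × ℤ} (h : A ⊆ B)
    (hA : ConnectsToInfinity A u) : ConnectsToInfinity B u := by
  refine Set.Infinite.mono (fun v hv => ?_) hA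
  obtain ⟨p, hp⟩ := hv
  exact ⟨p, fun w hw => h (hp w hw)⟩

theorem HasInfiniteCluster.mono {A B : Set (ℤ × ℤ)} (h : A ⊆ B) (hA : HasInfiniteCluster A) :
    HasInfiniteCluster B := by
  obtain ⟨u, hu, hinf⟩ := hA
  exact ⟨u, h hu, hinf.mono h⟩

theorem ConnectsToInfinity.hasInfiniteCluster {A : Set (ℤ × ℤ)} {u : ℤ × ℤ}
    (h : ConnectsToInfinity A u) : HasInfiniteCluster A := by
  obtain ⟨v, p, hp⟩ := Set.Infinite.nonempty h
  exact ⟨u, hp u p.start_mem_support, h⟩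

theorem measureReal_connectsToInfinity_eq_zero {P : Measure Ω} {A : Ω → Set (ℤ × ℤ)}
    (h : ∀ᵐ ω ∂P, ¬ HasInfiniteCluster (A ω)) (u : ℤ × ℤ) :
    P.real {ω | ConnectsToInfinity (A ω) u} = 0 := by
  have h0 : P {ω | ConnectsToInfinity (A ω) u} = 0 :=
    measure_mono_null (fun ω hω => not_not.mpr (ConnectsToInfinity.hasInfiniteCluster hω))
      (ae_iff.mp h)
  simp [Measure.real, h0]

theorem Sparse.measureReal_connectsToInfinity_ne_zero {P : Measure Ω} [IsProbabilityMeasure P]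
    {A B : Ω → Set (ℤ × ℤ)} (hB : Sparse P B ((1152⁻¹ : ℝ≥0∞) ^ 2)) (h : ∀ ω, (B ω)ᶜ ⊆ A ω) :
    P.real {ω | ConnectsToInfinity (A ω) (0, 0)} ≠ 0 := by
  rw [Ne, measureReal_eq_zero_iff]
  exact fun h0 => hB.measure_connectsToInfinity_compl_ne_zero
    (measure_mono_null (fun ω hω => ConnectsToInfinity.mono (h ω) hω) h0)

theorem lit_mono (x : ℤ × ℤ → ℝ) {ℓ ℓ' : ℝ} (h : ℓ ≤ ℓ') : lit x ℓ ⊆ lit x ℓ' :=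
  fun _ hu => le_trans hu (EReal.coe_le_coe_iff.mpr h)

theorem shadow_anti (x : ℤ × ℤ → ℝ) {ℓ ℓ' : ℝ} (h : ℓ ≤ ℓ') : shadow x ℓ' ⊆ shadow x ℓ :=
  fun _ hu => le_trans (EReal.coe_le_coe_iff.mpr h) hu

theorem compl_lit_subset_shadow (x : ℤ × ℤ → ℝ) (ℓ : ℝ) : (lit x ℓ)ᶜ ⊆ shadow x ℓ :=
  fun u (hu : ¬ alpha x u ≤ ℓ) => (not_le.mp hu).le

theorem compl_shadow_subset_lit (x : ℤ × ℤ → ℝ) (ℓ : ℝ) : (shadow x ℓ)ᶜ ⊆ lit x ℓ :=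
  fun u (hu : ¬ (ℓ : EReal) ≤ alpha x u) => (not_le.mp hu).le

theorem four_mul_sq_lt_one : 4 * (1152⁻¹ : ℝ≥0∞) ^ 2 < 1 := by
  rw [← ENNReal.toReal_lt_toReal (by finiteness) (by finiteness)]
  simp
  norm_num

end SunPercolation

open SunPercolation

theorem theorem1 {Ω : Type*} [MeasurableSpace Ω] (P : Measure Ω) [IsProbabilityMeasure P]
    (μ : Measure ℝ) (X : ℤ × ℤ → Ω → ℝ)
    (hX_meas : ∀ u, Measurable (X u))
    (hX_indep : iIndepFun X P)
    (hX_law : ∀ u, P.map (X u) = μ) :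
    (SunPercolation.HasLebesgueDensity μ →
      (∃ ℓ₁ : ℝ, 0 < ℓ₁ ∧ ∀ ℓ : ℝ, ℓ < ℓ₁ →
        (∀ᵐ ω ∂P, ¬ SunPercolation.HasInfiniteCluster
          (SunPercolation.lit (fun u => X u ω) ℓ)) ∧
        (∀ᵐ ω ∂P, SunPercolation.HasInfiniteCluster
          (SunPercolation.shadow (fun u => X u ω) ℓ))) ∧
      0 < SunPercolation.critLe P X ∧ 0 < SunPercolation.critGe P X) ∧
    (SunPercolation.HasExponentialTails μ →
      (∃ ℓ₂ : ℝ, ∀ ℓ : ℝ, ℓ₂ < ℓ →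
        (∀ᵐ ω ∂P, SunPercolation.HasInfiniteCluster
          (SunPercolation.lit (fun u => X u ω) ℓ)) ∧
        (∀ᵐ ω ∂P, ¬ SunPercolation.HasInfiniteCluster
          (SunPercolation.shadow (fun u => X u ω) ℓ))) ∧
      SunPercolation.critLe P X < ⊤ ∧ SunPercolation.critGe P X < ⊤) := by
  refine ⟨fun hμ => ?_, fun hμ => ?_⟩
  · have hprob : IsProbabilityMeasure μ :=
      hX_law 0 ▸ Measure.isProbabilityMeasure_map (hX_meas 0).aemeasurable
    have := hμ.nullSingletonClass
    obtain ⟨ℓ₁, hℓ₁, hB⟩ := exists_sparse_lit hX_meas hX_indep hX_law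
    have hnone := hB.ae_not_hasInfiniteCluster four_mul_sq_lt_one
    have hsub : ∀ ℓ ≤ ℓ₁, ∀ ω, (lit (fun u => X u ω) ℓ₁)ᶜ ⊆ shadow (fun u => X u ω) ℓ :=
      fun ℓ hℓ ω => (compl_lit_subset_shadow _ _).trans (shadow_anti _ hℓ)
    refine ⟨⟨ℓ₁, hℓ₁, fun ℓ hℓ => ⟨?_, ?_⟩⟩, ?_, ?_⟩
    · filter_upwards [hnone] with ω hω h
      exact hω (h.mono (lit_mono _ hℓ.le))
    · filter_upwards [hB.ae_hasInfiniteCluster_compl] with ω hω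
      exact hω.mono (hsub ℓ hℓ.le ω)
    · exact (EReal.coe_pos.mpr hℓ₁).trans_le
        (le_sSup ⟨ℓ₁, measureReal_connectsToInfinity_eq_zero hnone _, rfl⟩)
    · refine (EReal.coe_pos.mpr hℓ₁).trans_le (le_sInf ?_)
      rintro _ ⟨ℓ, hℓ, rfl⟩
      by_contra hlt
      have hle : ℓ ≤ ℓ₁ := (EReal.coe_lt_coe_iff.mp (not_le.mp hlt)).le
      exact hB.measureReal_connectsToInfinity_ne_zero (hsub ℓ hle) hℓ
  · obtain ⟨ℓ₂, hB⟩ := exists_sparse_shadow hX_meas hX_indep hX_law hμ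
    have hnone := hB.ae_not_hasInfiniteCluster four_mul_sq_lt_one
    have hsub : ∀ ℓ, ℓ₂ ≤ ℓ → ∀ ω, (shadow (fun u => X u ω) ℓ₂)ᶜ ⊆ lit (fun u => X u ω) ℓ :=
      fun ℓ hℓ ω => (compl_shadow_subset_lit _ _).trans (lit_mono _ hℓ)
    refine ⟨⟨ℓ₂, fun ℓ hℓ => ⟨?_, ?_⟩⟩, ?_, ?_⟩
    · filter_upwards [hB.ae_hasInfiniteCluster_compl] with ω hω
      exact hω.mono (hsub ℓ hℓ.le ω)
    · filter_upwards [hnone] with ω hω h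
      exact hω (h.mono (shadow_anti _ hℓ.le))
    · refine (sSup_le ?_).trans_lt (EReal.coe_lt_top ℓ₂)
      rintro _ ⟨ℓ, hℓ, rfl⟩
      by_contra hlt
      have hle : ℓ₂ ≤ ℓ := (EReal.coe_lt_coe_iff.mp (not_le.mp hlt)).le
      exact hB.measureReal_connectsToInfinity_ne_zero (hsub ℓ hle) hℓ
    · refine lt_of_le_of_lt (sInf_le (Set.mem_image_of_mem _ ?_)) (EReal.coe_lt_top ℓ₂)
      exact measureReal_connectsToInfinity_eq_zero hnone _
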